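/- Let $T$ be a compact Hausdorff space (for instance a compact metric space), let $t\mapsto a_t\in\mathbb{R}^n$ and $t\mapsto \overline b_t\in\mathbb{R}$ be continuous on $T$, and let $\mathbb{R}^n$ carry an arbitrary norm and $C(T,\mathbb{R})$ the supremum norm. For $b\in C(T,\mathbb{R})$ put $$\mathcal F(b):=\{x\in\mathbb{R}^n \mid a_t'x\le b_t \text{ for all } t\in T\},\qquad f_b(x):=\sup_{t\in T}(a_t'x-b_t),$$ where $u'x$ is the usual inner product. For $x\in\mathcal F(\overline b)$ let $T(x):=\{t\in T\mid a_t'x=\overline b_t\}$, and let $A(x)$ be the convex cone (always containing $0$) generated by $\{a_t\mid t\in T(x)\}$. Write $S^\circ:=\{u\in\mathbb{R}^n\mid u'x\le 0 \text{ for all } x\in S\}$, let $\partial f$ denote the subdifferential of convex analysis, and for $C\subset\mathbb{R}^n$ let $$\operatorname{end} C:=\{u\in\operatorname{cl}C \mid \text{there is no } \mu>1 \text{ with } \mu u\in\operatorname{cl} C\}.$$ The regularity condition at $\overline x\in\mathcal F(\overline b)$ says that there is a neighborhood $W$ of $\overline x$ with $\mathcal F(\overline b)\cap W=(\overline x+A(\overline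 x)^\circ)\cap W$. The calmness modulus $\operatorname{clm}\mathcal F(\overline b,\overline x)\in[0,+\infty]$ is the infimum ($+\infty$ if there are none) of the constants $\kappa\ge 0$ for which there is a neighborhood $U$ of $\overline x$ with $d(x,\mathcal F(\overline b))\le\kappa\, d(\overline b,\mathcal F^{-1}(x))$ for all $x\in U$, where $\mathcal F^{-1}(x)=\{b\in C(T,\mathbb{R})\mid x\in\mathcal F(b)\}$. Let $x^1,x^2$ be boundary points of $\mathcal F(\overline b)$ such that $T(x^1)\subseteq T(x^2)$. Then: (i) $\operatorname{end}\partial f_{\overline b}(x^1)\subseteq\operatorname{end}\partial f_{\overline b}(x^2)$; (ii) if the regularity condition holds at both $x^1$ and $x^2$, then $\operatorname{clm}\mathcal F(\overline b,x^1)\le\operatorname{clm}\mathcal F(\overline b,x^2)$. -/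

import Mathlib

open Set Filter Topology
open scoped NNReal ENNReal Matrix

noncomputable section

/-- A norm on `ℝⁿ`, not tied to the one that Mathlib puts on `Fin n → ℝ`. -/
structure VecNorm (n : ℕ) extends Seminorm ℝ (Fin n → ℝ) where
  eq_zero_of_apply_eq_zero : ∀ x : Fin n → ℝ, toFun x = 0 → x = 0

/-- `ℝⁿ` equipped with the norm `N`. -/
structure NormedRn (n : ℕ) (N : VecNorm n) where
  /-- The point with the given coordinates. -/
  mk ::
  /-- The coordinates of a point. -/
  coords : Fin n → ℝ

namespace NormedRn

variable {n : ℕ} {N : VecNorm n}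

/-- A point is determined by its coordinates. -/
def equivCoords : NormedRn n N ≃ (Fin n → ℝ) where
  toFun := coords
  invFun := mk
  left_inv _ := rfl
  right_inv _ := rfl

instance : AddCommGroup (NormedRn n N) := equivCoords.addCommGroup

instance : Module ℝ (NormedRn n N) := equivCoords.module ℝ

instance : Norm (NormedRn n N) := ⟨fun x => N.toSeminorm x.coords⟩

theorem coords_add (x y : NormedRn n N) : (x + y).coords = x.coords + y.coords := rfl

theorem coords_zero : (0 : NormedRn n N).coords = 0 := rfl

theorem coords_sub (x y : NormedRn n N) : (x - y).coords = x.coords - y.coords := rfl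

theorem coords_smul (c : ℝ) (x : NormedRn n N) : (c • x).coords = c • x.coords := rfl

theorem normedSpaceCore : NormedSpace.Core ℝ (NormedRn n N) where
  norm_nonneg x := apply_nonneg N.toSeminorm x.coords
  norm_smul c x := map_smul_eq_mul N.toSeminorm c x.coords
  norm_triangle x y := map_add_le_add N.toSeminorm x.coords y.coords
  norm_eq_zero_iff x := by
    constructor
    · intro h
      exact equivCoords.injective (N.eq_zero_of_apply_eq_zero x.coords h)
    · rintro rfl
      exact map_zero N.toSeminorm

instance : NormedAddCommGroup (NormedRn n N) := NormedAddCommGroup.ofCore normedSpaceCore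

instance : NormedSpace ℝ (NormedRn n N) := NormedSpace.ofCore normedSpaceCore

end NormedRn

/-- The inverse of a multifunction. -/
def multiInverse {Y X : Type*} (M : Y → Set X) (x : X) : Set Y :=
  {y | x ∈ M y}

/-- The calmness modulus of the multifunction `M` at `(y₀, x₀)`: the infimum, `∞` if there are none,
of the constants `κ ≥ 0` such that `d(x, M y₀) ≤ κ d(y₀, M⁻¹ x)` for all `x` near `x₀`. -/
def calmnessModulus {Y X : Type*} [MetricSpace Y] [MetricSpace X] (M : Y → Set X)
    (y₀ : Y) (x₀ : X) : ℝ≥0∞ :=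
  ⨅ (κ : ℝ≥0) (_ : ∃ U ∈ 𝓝 x₀, ∀ x ∈ U,
    Metric.infEDist x (M y₀) ≤ (κ : ℝ≥0∞) * Metric.infEDist y₀ (multiInverse M x)), (κ : ℝ≥0∞)

/-- The end set of `C`. -/
def endSet {n : ℕ} (C : Set (Fin n → ℝ)) : Set (Fin n → ℝ) :=
  {u | u ∈ closure C ∧ ¬ ∃ μ : ℝ, 1 < μ ∧ μ • u ∈ closure C}

/-- The (negative) polar of `S`. -/
def negPolar {n : ℕ} (S : Set (Fin n → ℝ)) : Set (Fin n → ℝ) :=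
  {u | ∀ x ∈ S, u ⬝ᵥ x ≤ 0}

/-- The subdifferential at `x` of a function on `ℝⁿ`. -/
def subdiff {n : ℕ} {N : VecNorm n} (f : NormedRn n N → ℝ) (x : NormedRn n N) :
    Set (Fin n → ℝ) :=
  {u | ∀ y : NormedRn n N, f x + u ⬝ᵥ (y.coords - x.coords) ≤ f y}

section LinearSystem

variable {n : ℕ} (N : VecNorm n) {T : Type*} [TopologicalSpace T] [CompactSpace T]

/-- The feasible set of the system `aₜ' x ≤ bₜ`, `t ∈ T`. -/
def feasibleSet (a : C(T, Fin n → ℝ)) (b : C(T, ℝ)) : Set (NormedRn n N) :=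
  {x | ∀ t, a t ⬝ᵥ x.coords ≤ b t}

/-- The supremum function `f_b` of the system. -/
def supFun (a : C(T, Fin n → ℝ)) (b : C(T, ℝ)) (x : NormedRn n N) : ℝ :=
  ⨆ t, (a t ⬝ᵥ x.coords - b t)

variable {N}

/-- The set of active indices at `x`. -/
def activeIndices (a : C(T, Fin n → ℝ)) (b : C(T, ℝ)) (x : NormedRn n N) : Set T :=
  {t | a t ⬝ᵥ x.coords - b t = 0}

/-- The active cone at `x`: the convex cone, always containing `0`, generated by the active `aₜ`. -/
def activeCone (a : C(T, Fin n → ℝ)) (b : C(T, ℝ)) (x : NormedRn n N) :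
    PointedCone ℝ (Fin n → ℝ) :=
  PointedCone.hull ℝ (a '' activeIndices a b x)

/-- The regularity condition at `x₀`: near `x₀`, the feasible set is `x₀` plus the polar of the
active cone. -/
def RegularAt (a : C(T, Fin n → ℝ)) (b : C(T, ℝ)) (x₀ : NormedRn n N) : Prop :=
  ∃ W ∈ 𝓝 x₀, feasibleSet N a b ∩ W =
    {x : NormedRn n N | x.coords - x₀.coords ∈
      negPolar (activeCone a b x₀ : Set (Fin n → ℝ))} ∩ W

end LinearSystem

end

/-! Write f for `supFun`; it vanishes at both boundary points. (i) If u is a subgradient at x₁, the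
inequality at x₂ gives u'(x₂ - x₁) ≤ 0. Constraints active at x₁ are active at x₂, hence constant
along the line through both points, so f is o(r) at x₁ + r(x₁ - x₂) and u'(x₁ - x₂) ≤ 0. With u'x₁ =
u'x₂, the subgradient inequalities of u, or of any μu, at x₁ and x₂ coincide
(`dotProduct_eq_of_mem_subdiff`, `mem_subdiff_of_dotProduct_eq`). (ii) A calmness constant κ on a
neighborhood of x₂ also works at points y of the segment towards x₁, where the active set is T(x₁)
(`exists_activeIndices_eq_near`). Blowing up at y turns it into an error bound, with the same κ, for
the homogeneous system aₜ'w ≤ 0, t ∈ T(x₁) (`exists_active_direction`). Regularity at x₁ carries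
this bound back to the feasible set near x₁. -/

namespace NormedRn

variable {n : ℕ} {N : VecNorm n}

/-- The coordinates as a linear equivalence. -/
def coordsLinearEquiv (N : VecNorm n) : NormedRn n N ≃ₗ[ℝ] (Fin n → ℝ) where
  toFun := coords
  invFun := mk
  left_inv _ := rfl
  right_inv _ := rfl
  map_add' _ _ := rfl
  map_smul' _ _ := rfl

instance : FiniteDimensional ℝ (NormedRn n N) :=
  (coordsLinearEquiv N).symm.finiteDimensional

theorem continuous_coords : Continuous (coords : NormedRn n N → Fin n → ℝ) :=
  (coordsLinearEquiv N).toLinearMap.continuous_of_finiteDimensional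

end NormedRn

section

variable {n : ℕ} {N : VecNorm n} {T : Type*} [TopologicalSpace T] [CompactSpace T]
  {a : C(T, Fin n → ℝ)} {b : C(T, ℝ)}

/-! ### Feasible set, active indices and first-order growth of the slacks. -/

omit [CompactSpace T] in
theorem continuous_slack (a : C(T, Fin n → ℝ)) (b : C(T, ℝ)) :
    Continuous fun p : (Fin n → ℝ) × T => a p.2 ⬝ᵥ p.1 - b p.2 := by
  have : Continuous fun p : (Fin n → ℝ) × T => a p.2 := a.continuous.comp continuous_snd
  have := this.dotProduct continuous_fst
  have := b.continuous.comp (continuous_snd : Continuous (Prod.snd : (Fin n → ℝ) × T → T))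
  fun_prop

omit [CompactSpace T] in
theorem isClosed_feasibleSet : IsClosed (feasibleSet N a b) := by
  have : feasibleSet N a b = ⋂ t, {x | a t ⬝ᵥ x.coords ≤ b t} := by
    ext x; simp [feasibleSet]
  rw [this]
  exact isClosed_iInter fun t => isClosed_le
    (continuous_const.dotProduct NormedRn.continuous_coords) continuous_const

omit [CompactSpace T] in
theorem mem_feasibleSet_of_mem_frontier {x : NormedRn n N}
    (hx : x ∈ frontier (feasibleSet N a b)) : x ∈ feasibleSet N a b :=
  isClosed_feasibleSet.frontier_subset hx

/-- If every constraint were strict at `x`, compactness of `T` would keep them all strict nearby,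
making `x` interior. -/
theorem activeIndices_nonempty_of_mem_frontier {x : NormedRn n N}
    (hx : x ∈ frontier (feasibleSet N a b)) : (activeIndices a b x).Nonempty := by
  by_contra hne
  rw [not_nonempty_iff_eq_empty] at hne
  refine hx.2 (mem_interior_iff_mem_nhds.2 ?_)
  have hlt : ∀ t, a t ⬝ᵥ x.coords - b t < 0 := fun t =>
    lt_of_le_of_ne (sub_nonpos.2 (mem_feasibleSet_of_mem_frontier hx t)) fun h =>
      (hne ▸ (show t ∈ activeIndices a b x from h) : t ∈ (∅ : Set T))
  have key : ∀ᶠ y in 𝓝 x.coords, ∀ t ∈ (univ : Set T), a t ⬝ᵥ y - b t < 0 :=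
    isCompact_univ.eventually_forall_of_forall_eventually fun t _ =>
      (continuous_slack a b).continuousAt.eventually_lt_const (hlt t)
  filter_upwards [NormedRn.continuous_coords.continuousAt.eventually key] with y hy t
  exact (sub_neg.1 (hy t (mem_univ t))).le

theorem le_supFun (x : NormedRn n N) (t : T) : a t ⬝ᵥ x.coords - b t ≤ supFun N a b x := by
  refine le_ciSup (f := fun t => a t ⬝ᵥ x.coords - b t) (IsCompact.bddAbove (isCompact_range ?_)) t
  exact (continuous_slack a b).comp (Continuous.prodMk_right x.coords)

theorem supFun_eq_zero_of_mem_frontier {x : NormedRn n N}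
    (hx : x ∈ frontier (feasibleSet N a b)) : supFun N a b x = 0 := by
  obtain ⟨t, ht⟩ := activeIndices_nonempty_of_mem_frontier hx
  have : Nonempty T := ⟨t⟩
  refine le_antisymm (ciSup_le fun s => sub_nonpos.2 (mem_feasibleSet_of_mem_frontier hx s)) ?_
  exact (show a t ⬝ᵥ x.coords - b t = 0 from ht) ▸ le_supFun x t

/-- One-sided directional estimate for the supremum function at a feasible point: it grows along
`d` at most as fast as the active functions do. -/
theorem eventually_forall_slack_le {y : Fin n → ℝ} (hy : ∀ t, a t ⬝ᵥ y ≤ b t) {d : Fin n → ℝ}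
    {c ε : ℝ} (hc : ∀ t, a t ⬝ᵥ y - b t = 0 → a t ⬝ᵥ d ≤ c) (hε : 0 < ε) :
    ∀ᶠ r : ℝ in 𝓝[>] 0, ∀ t, a t ⬝ᵥ (y + r • d) - b t ≤ r * (c + ε) := by
  have key : ∀ᶠ r : ℝ in 𝓝 0, ∀ t ∈ (univ : Set T),
      0 < r → a t ⬝ᵥ (y + r • d) - b t ≤ r * (c + ε) := by
    refine isCompact_univ.eventually_forall_of_forall_eventually fun t _ => ?_
    -- Near an active index the slope stays below `c + ε` and feasibility of `y` bounds the rest;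
    -- near an inactive one the slack is negative at `r = 0`, which beats the small term `r * (c +
    -- ε)` of either sign.
    by_cases ht : a t ⬝ᵥ y - b t = 0
    · have hcont : Continuous fun p : ℝ × T => a p.2 ⬝ᵥ d :=
        (a.continuous.comp continuous_snd).dotProduct continuous_const
      have hlt : (fun p : ℝ × T => a p.2 ⬝ᵥ d) (0, t) < c + ε := by
        have := hc t ht
        dsimp only
        linarith
      filter_upwards [hcont.continuousAt.eventually_lt_const hlt] with p hp hp0
      have h1 := mul_le_mul_of_nonneg_left hp.le hp0.le
      have h2 := hy p.2
      rw [dotProduct_add, dotProduct_smul, smul_eq_mul]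
      linarith
    · have hcont : Continuous fun p : ℝ × T =>
          a p.2 ⬝ᵥ (y + p.1 • d) - b p.2 - p.1 * (c + ε) := by
        have := (continuous_slack a b).comp
          (show Continuous fun p : ℝ × T => (y + p.1 • d, p.2) by fun_prop)
        exact this.sub (by fun_prop)
      have hlt : (fun p : ℝ × T => a p.2 ⬝ᵥ (y + p.1 • d) - b p.2 - p.1 * (c + ε)) (0, t) < 0 := by
        have := lt_of_le_of_ne (sub_nonpos.2 (hy t)) ht
        simpa using this
      filter_upwards [hcont.continuousAt.eventually_lt_const hlt] with p hp _
      linarith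
  filter_upwards [nhdsWithin_le_nhds key, self_mem_nhdsWithin] with r hr hr0 t
  exact hr t (mem_univ t) hr0

/-! ### Subdifferentials and end sets. -/

theorem isClosed_subdiff (f : NormedRn n N → ℝ) (x : NormedRn n N) : IsClosed (subdiff f x) := by
  have : subdiff f x = ⋂ y : NormedRn n N, {u | f x + u ⬝ᵥ (y.coords - x.coords) ≤ f y} := by
    ext u; simp [subdiff]
  rw [this]
  exact isClosed_iInter fun y => isClosed_le
    (continuous_const.add (continuous_id.dotProduct continuous_const)) continuous_const

theorem dotProduct_eq_of_mem_subdiff {x₁ x₂ : NormedRn n N}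
    (hx₁ : x₁ ∈ frontier (feasibleSet N a b)) (hx₂ : x₂ ∈ frontier (feasibleSet N a b))
    (hT : activeIndices a b x₁ ⊆ activeIndices a b x₂) {u : Fin n → ℝ}
    (hu : u ∈ subdiff (supFun N a b) x₁) : u ⬝ᵥ x₁.coords = u ⬝ᵥ x₂.coords := by
  have : Nonempty T := (activeIndices_nonempty_of_mem_frontier hx₁).to_type
  have h1 := hu x₂
  rw [supFun_eq_zero_of_mem_frontier hx₁, supFun_eq_zero_of_mem_frontier hx₂, zero_add,
    dotProduct_sub] at h1
  refine le_antisymm (le_of_forall_pos_le_add fun ε hε => ?_) (by linarith)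
  have hc : ∀ t, a t ⬝ᵥ x₁.coords - b t = 0 → a t ⬝ᵥ (x₁.coords - x₂.coords) ≤ 0 := by
    intro t ht
    have h2 : a t ⬝ᵥ x₂.coords - b t = 0 := hT ht
    rw [dotProduct_sub]
    linarith
  obtain ⟨r, hr, hr0⟩ := ((eventually_forall_slack_le (mem_feasibleSet_of_mem_frontier hx₁) hc
    hε).and self_mem_nhdsWithin).exists
  have h3 : supFun N a b (x₁ + r • (x₁ - x₂)) ≤ r * (0 + ε) := ciSup_le hr
  have h4 := (hu (x₁ + r • (x₁ - x₂))).trans h3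
  rw [supFun_eq_zero_of_mem_frontier hx₁, NormedRn.coords_add, add_sub_cancel_left,
    NormedRn.coords_smul, NormedRn.coords_sub, dotProduct_smul, smul_eq_mul, dotProduct_sub] at h4
  have := le_of_mul_le_mul_left ((zero_add _).symm.trans_le h4) hr0
  linarith

theorem mem_subdiff_of_dotProduct_eq {f : NormedRn n N → ℝ} {x₁ x₂ : NormedRn n N}
    (hf : f x₁ = f x₂) {u : Fin n → ℝ} (hu : u ∈ subdiff f x₁)
    (h : u ⬝ᵥ x₁.coords = u ⬝ᵥ x₂.coords) : u ∈ subdiff f x₂ := by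
  intro y
  have := hu y
  rwa [dotProduct_sub, hf, h, ← dotProduct_sub] at this

theorem endSet_subdiff_subset {x₁ x₂ : NormedRn n N}
    (hx₁ : x₁ ∈ frontier (feasibleSet N a b)) (hx₂ : x₂ ∈ frontier (feasibleSet N a b))
    (hT : activeIndices a b x₁ ⊆ activeIndices a b x₂) :
    endSet (subdiff (supFun N a b) x₁) ⊆ endSet (subdiff (supFun N a b) x₂) := by
  rintro u ⟨hu, hend⟩
  simp only [endSet, (isClosed_subdiff _ _).closure_eq, mem_ofPred_eq] at hu hend ⊢
  have hf : supFun N a b x₁ = supFun N a b x₂ := by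
    rw [supFun_eq_zero_of_mem_frontier hx₁, supFun_eq_zero_of_mem_frontier hx₂]
  have heq := dotProduct_eq_of_mem_subdiff hx₁ hx₂ hT hu
  refine ⟨mem_subdiff_of_dotProduct_eq hf hu heq, ?_⟩
  rintro ⟨μ, hμ, hmem⟩
  refine hend ⟨μ, hμ, mem_subdiff_of_dotProduct_eq hf.symm hmem ?_⟩
  rw [smul_dotProduct, smul_dotProduct, heq]

/-! ### Calmness moduli. -/

omit [CompactSpace T] in
theorem mem_negPolar_activeCone {x : NormedRn n N} {w : Fin n → ℝ}
    (hw : ∀ t ∈ activeIndices a b x, a t ⬝ᵥ w ≤ 0) :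
    w ∈ negPolar (activeCone a b x : Set (Fin n → ℝ)) := by
  intro v hv
  induction hv using Submodule.span_induction with
  | mem v hv =>
    obtain ⟨t, ht, rfl⟩ := hv
    rw [dotProduct_comm]
    exact hw t ht
  | zero => simp
  | add v v' _ _ h h' => rw [dotProduct_add]; linarith
  | smul c v _ h =>
    have : w ⬝ᵥ (c • v) = (c : ℝ) * (w ⬝ᵥ v) := dotProduct_smul (c : ℝ) w v
    rw [this]
    exact mul_nonpos_of_nonneg_of_nonpos c.2 h

/-- Raising the right-hand side by the constant `c` makes `x` feasible. -/
theorem infEDist_multiInverse_le {x : NormedRn n N} {c : ℝ} (hc : 0 ≤ c)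
    (h : ∀ t, a t ⬝ᵥ x.coords - b t ≤ c) :
    Metric.infEDist b (multiInverse (feasibleSet N a) x) ≤ ENNReal.ofReal c := by
  have hmem : b + ContinuousMap.const T c ∈ multiInverse (feasibleSet N a) x := fun t => by
    have := h t
    simp only [ContinuousMap.add_apply, ContinuousMap.const_apply]
    linarith
  refine (Metric.infEDist_le_edist_of_mem hmem).trans ?_
  rw [edist_dist]
  refine ENNReal.ofReal_le_ofReal ((ContinuousMap.dist_le hc).2 fun t => ?_)
  simp [abs_of_nonneg hc]

/-- A point with the same active indices as `x₁` at which the feasible set satisfies a calmness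
estimate yields approximate solutions of the homogeneous active system at `x₁`. -/
theorem exists_active_direction {x₁ y : NormedRn n N} (hy : y ∈ feasibleSet N a b)
    (hT : activeIndices a b y = activeIndices a b x₁) {κ : ℝ≥0} {U : Set (NormedRn n N)}
    (hyU : U ∈ 𝓝 y) (hU : ∀ x ∈ U, Metric.infEDist x (feasibleSet N a b) ≤
      (κ : ℝ≥0∞) * Metric.infEDist b (multiInverse (feasibleSet N a) x))
    {d : NormedRn n N} {c ε : ℝ} (hc : 0 ≤ c) (hε : 0 < ε)
    (hd : ∀ t ∈ activeIndices a b x₁, a t ⬝ᵥ d.coords ≤ c) :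
    ∃ w : NormedRn n N, (∀ t ∈ activeIndices a b x₁, a t ⬝ᵥ w.coords ≤ 0) ∧
      dist d w ≤ κ * (c + ε) + ε := by
  have hlim : Tendsto (fun r : ℝ => y + r • d) (𝓝[>] 0) (𝓝 y) := by
    have : Continuous fun r : ℝ => y + r • d := by fun_prop
    exact (this.tendsto' 0 y (by simp)).mono_left nhdsWithin_le_nhds
  obtain ⟨r, ⟨hr, hrU⟩, hr0⟩ := (((eventually_forall_slack_le (d := d.coords) (c := c) hy
    (fun t ht => hd t (hT ▸ ht)) hε).and (hlim.eventually hyU)).and self_mem_nhdsWithin).exists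
  replace hr0 : 0 < r := hr0
  have hκ := κ.coe_nonneg
  -- The extra `ε` makes the bound strict, so that some feasible `z` realizes it.
  have h1 : Metric.infEDist (y + r • d) (feasibleSet N a b) <
      ENNReal.ofReal (r * (κ * (c + ε) + ε)) := by
    refine ((hU _ hrU).trans (mul_le_mul_right (infEDist_multiInverse_le
      (by positivity) hr) _)).trans_lt ?_
    rw [← ENNReal.ofReal_coe_nnreal, ← ENNReal.ofReal_mul hκ]
    refine (ENNReal.ofReal_lt_ofReal_iff (by positivity)).2 ?_
    nlinarith [mul_pos hr0 hε]
  obtain ⟨z, hz, hlt⟩ := Metric.infEDist_lt_iff.1 h1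
  rw [edist_dist, ENNReal.ofReal_lt_ofReal_iff (by positivity)] at hlt
  refine ⟨r⁻¹ • (z - y), fun t ht => ?_, ?_⟩
  · have h2 : a t ⬝ᵥ y.coords - b t = 0 := (hT ▸ ht : t ∈ activeIndices a b y)
    have h3 := hz t
    rw [NormedRn.coords_smul, NormedRn.coords_sub, dotProduct_smul, smul_eq_mul, dotProduct_sub]
    exact mul_nonpos_of_nonneg_of_nonpos (by positivity) (by linarith)
  · have h4 : y + r • d - z = r • (d - r⁻¹ • (z - y)) := by
      rw [smul_sub, smul_inv_smul₀ hr0.ne']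
      abel
    rw [dist_eq_norm, h4, norm_smul, Real.norm_of_nonneg hr0.le] at hlt
    rw [dist_eq_norm]
    exact (lt_of_mul_lt_mul_left hlt hr0.le).le

omit [CompactSpace T] in
/-- Points with the active indices of `x₁` exist arbitrarily close to `x₂`. -/
theorem exists_activeIndices_eq_near {x₁ x₂ : NormedRn n N} (hx₁ : x₁ ∈ feasibleSet N a b)
    (hx₂ : x₂ ∈ feasibleSet N a b) (hT : activeIndices a b x₁ ⊆ activeIndices a b x₂)
    {U : Set (NormedRn n N)} (hU : U ∈ 𝓝 x₂) :
    ∃ y ∈ feasibleSet N a b, activeIndices a b y = activeIndices a b x₁ ∧ U ∈ 𝓝 y := by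
  have hlim : Tendsto (fun r : ℝ => x₂ + r • (x₁ - x₂)) (𝓝[>] 0) (𝓝 x₂) := by
    have : Continuous fun r : ℝ => x₂ + r • (x₁ - x₂) := by fun_prop
    exact (this.tendsto' 0 x₂ (by simp)).mono_left nhdsWithin_le_nhds
  obtain ⟨r, hrU, hr0, hr1⟩ := ((hlim.eventually (eventually_mem_nhds_iff.2 hU)).and
    (Ioo_mem_nhdsGT (zero_lt_one (α := ℝ)))).exists
  have hslack : ∀ t, a t ⬝ᵥ (x₂ + r • (x₁ - x₂)).coords - b t =
      (1 - r) * (a t ⬝ᵥ x₂.coords - b t) + r * (a t ⬝ᵥ x₁.coords - b t) := fun t => by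
    rw [NormedRn.coords_add, NormedRn.coords_smul, NormedRn.coords_sub, dotProduct_add,
      dotProduct_smul, dotProduct_sub, smul_eq_mul]
    ring
  refine ⟨_, fun t => ?_, ?_, hrU⟩
  · have h1 := mul_nonneg (sub_nonneg.2 hr1.le) (sub_nonneg.2 (hx₂ t))
    have h2 := mul_nonneg hr0.le (sub_nonneg.2 (hx₁ t))
    have h3 := hslack t
    linarith
  · ext t
    refine ⟨fun ht => ?_, fun ht => ?_⟩
    · have h0 : a t ⬝ᵥ (x₂ + r • (x₁ - x₂)).coords - b t = 0 := ht
      rw [hslack] at h0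
      have h1 := mul_nonneg (sub_nonneg.2 hr1.le) (sub_nonneg.2 (hx₂ t))
      have h2 := mul_nonneg hr0.le (sub_nonneg.2 (hx₁ t))
      -- Two nonpositive terms with sum zero both vanish.
      have h3 : r * (a t ⬝ᵥ x₁.coords - b t) = 0 := by linarith
      exact (mul_eq_zero.1 h3).resolve_left hr0.ne'
    · have h1 : a t ⬝ᵥ x₁.coords - b t = 0 := ht
      have h2 : a t ⬝ᵥ x₂.coords - b t = 0 := hT ht
      change _ = _
      rw [hslack, h1, h2, mul_zero, mul_zero, add_zero]

theorem calmnessModulus_le_of_activeIndices_subset {x₁ x₂ : NormedRn n N}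
    (hx₁ : x₁ ∈ feasibleSet N a b) (hx₂ : x₂ ∈ feasibleSet N a b)
    (hT : activeIndices a b x₁ ⊆ activeIndices a b x₂) (hreg : RegularAt a b x₁) :
    calmnessModulus (feasibleSet N a) b x₁ ≤ calmnessModulus (feasibleSet N a) b x₂ := by
  refine le_iInf₂ fun κ ⟨U, hU₂, hU⟩ => iInf₂_le κ ?_
  obtain ⟨y, hy, hyT, hyU⟩ := exists_activeIndices_eq_near hx₁ hx₂ hT hU₂
  obtain ⟨W, hW, hWeq⟩ := hreg
  obtain ⟨R, hR, hRW⟩ := Metric.mem_nhds_iff.1 hW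
  have hκ := κ.coe_nonneg
  have bound : ∀ x ∈ Metric.ball x₁ (R / 2), ∀ b' ∈ multiInverse (feasibleSet N a) x,
      Metric.infEDist x (feasibleSet N a b) ≤ (κ : ℝ≥0∞) * edist b b' := by
    intro x hx b' hb'
    have hc : ∀ t ∈ activeIndices a b x₁, a t ⬝ᵥ (x - x₁).coords ≤ dist b b' := by
      intro t ht
      have h1 : a t ⬝ᵥ x₁.coords - b t = 0 := ht
      have h2 : a t ⬝ᵥ x.coords ≤ b' t := hb' t
      have h3 := ContinuousMap.dist_apply_le_dist (f := b) (g := b') t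
      rw [Real.dist_eq, abs_sub_comm] at h3
      have h4 := le_abs_self (b' t - b t)
      rw [NormedRn.coords_sub, dotProduct_sub]
      linarith
    have approx : ∀ ε : ℝ, 0 < ε → Metric.infEDist x (feasibleSet N a b) ≤
        ENNReal.ofReal (κ * (dist b b' + ε) + ε) := by
      intro ε hε
      obtain ⟨w, hw, hdw⟩ := exists_active_direction hy hyT hyU hU dist_nonneg hε hc
      -- Either `x₁` itself is close enough to `x`, or the bound is at most `dist x x₁ < R / 2`;
      -- then `x₁ + w` lies within `R` of `x₁`, where regularity makes it feasible.
      rcases le_total (dist x x₁) (κ * (dist b b' + ε) + ε) with h | h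
      · refine (Metric.infEDist_le_edist_of_mem hx₁).trans ?_
        rw [edist_dist]
        exact ENNReal.ofReal_le_ofReal h
      · have hxw : dist x (x₁ + w) ≤ κ * (dist b b' + ε) + ε := by
          rw [dist_eq_norm] at hdw ⊢
          rwa [sub_add_eq_sub_sub]
        have hmem : x₁ + w ∈ W := by
          refine hRW ?_
          have := dist_triangle (x₁ + w) x x₁
          rw [dist_comm _ x] at this
          rw [Metric.mem_ball] at hx ⊢
          linarith
        have hF : x₁ + w ∈ feasibleSet N a b ∩ W := by
          rw [hWeq]
          refine ⟨?_, hmem⟩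
          change (x₁ + w).coords - x₁.coords ∈ negPolar (activeCone a b x₁ : Set (Fin n → ℝ))
          rw [NormedRn.coords_add, add_sub_cancel_left]
          exact mem_negPolar_activeCone hw
        refine (Metric.infEDist_le_edist_of_mem hF.1).trans ?_
        rw [edist_dist]
        exact ENNReal.ofReal_le_ofReal hxw
    rw [edist_dist, ← ENNReal.ofReal_coe_nnreal, ← ENNReal.ofReal_mul hκ]
    have hlim : Tendsto (fun ε : ℝ => ENNReal.ofReal (κ * (dist b b' + ε) + ε)) (𝓝[>] 0)
        (𝓝 (ENNReal.ofReal (κ * dist b b'))) := by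
      refine (ENNReal.continuous_ofReal.comp ?_).tendsto' 0 _ (by simp) |>.mono_left
        nhdsWithin_le_nhds
      fun_prop
    exact ge_of_tendsto hlim (eventually_mem_nhdsWithin.mono approx)
  refine ⟨_, Metric.ball_mem_nhds x₁ (half_pos hR), fun x hx => ?_⟩
  -- Needed to move the factor inside the infimum: for `κ = 0` an empty infimum would give `0 * ∞ =
  -- 0`.
  have : Nonempty (multiInverse (feasibleSet N a) x) := by
    refine ⟨⟨⟨fun t => a t ⬝ᵥ x.coords, a.continuous.dotProduct continuous_const⟩, fun t => ?_⟩⟩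
    exact le_rfl
  have hinf : Metric.infEDist b (multiInverse (feasibleSet N a) x) =
      ⨅ b' : multiInverse (feasibleSet N a) x, edist b b' := iInf_subtype'
  rw [hinf, ENNReal.mul_iInf (by simp)]
  exact le_iInf fun b' => bound x hx b' b'.2

end

theorem mainTheorem6 {n : ℕ} (N : VecNorm n) {T : Type*} [TopologicalSpace T] [CompactSpace T]
    [T2Space T] (a : C(T, Fin n → ℝ)) (b : C(T, ℝ)) (x₁ x₂ : NormedRn n N)
    (hx₁ : x₁ ∈ frontier (feasibleSet N a b)) (hx₂ : x₂ ∈ frontier (feasibleSet N a b))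
    (hT : activeIndices a b x₁ ⊆ activeIndices a b x₂) :
    endSet (subdiff (supFun N a b) x₁) ⊆ endSet (subdiff (supFun N a b) x₂) ∧
      (RegularAt a b x₁ → RegularAt a b x₂ →
        calmnessModulus (feasibleSet N a) b x₁ ≤ calmnessModulus (feasibleSet N a) b x₂) :=
  ⟨endSet_subdiff_subset hx₁ hx₂ hT, fun hreg _ => calmnessModulus_le_of_activeIndices_subset
    (mem_feasibleSet_of_mem_frontier hx₁) (mem_feasibleSet_of_mem_frontier hx₂) hT hreg⟩
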